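/- An instance of planar three-dimensional matching (P3DM) consists of pairwise disjoint finite sets $X,Y,Z$ with $|X|=|Y|=|Z|=q$ and a set $T\subseteq X\times Y\times Z$ such that every element of $X\cup Y\cup Z$ occurs in at most three triples of $T$, and such that the graph with vertex set $(X\cup Y\cup Z)\sqcup T$, in which each triple is adjacent to its three elements, is planar. Its answer is YES if there is $T'\subseteq T$ such that each element of $X\cup Y\cup Z$ is contained in exactly one triple of $T'$. A graph $G_{TP}$ of the instance is obtained as follows. Take a rectilinear layout of the above planar graph: vertices at distinct integer points, edges drawn without crossings along horizontal and vertical grid segments. Multiply all coordinates by $1000$. Each element stays as an *element point*. Each triple is replaced, in place (its vertices differ by at most $4$ in each coordinate from the scaled position), by a *triple triangle*: a triangle with side lengths $3,4,5$, integer vertices and axis-parallel legs, whose three vertices represent the three elements of the triple. Each edge is replaced by a *triangle path* from the element point to the vertex of the triple triangle that represents the element: a sequence of $k\ge 2$ axis-parallel $3\times 4$ rectangles with corners $J_i,J_{i+1}$ opposite in the $i$-th rectangle ($0\le i<k$), where $J_0$ is the element point and $J_k$ the vertex of the triple triangle; the $i$-th rectangle is cut by its diagonal not containing $J_i,J_{i+1}$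 into two 3-4-5 triangles, first the one at $J_i$, then the one at $J_{i+1}$. The first rectangle has its longer side vertical, the second one horizontal, the others are arbitrary. All triangles are pairwise different and form a plane figure (two of them meet only in common vertices or a common side); in particular consecutive rectangles of a path are connected at one or two vertices, and the first two at just one. All vertices are distributed over three disjoint sets $P_1,P_2,P_3$ so that the three vertices of every triangle lie in three different sets. In these sets each element point, each vertex of a triple triangle and each $J_i$ with $0<i<k$ of each path is listed once, and each of the two other corners of a rectangle is listed once for each rectangle of a triangle path of which it is such a corner (so a vertex, other than an element point, that is shared by two paths is listed twice). A *pattern of alternating triangles* in $G_{TP}$ is a partition of the listed points of $P_1,P_2,P_3$ into triples (triangles) with one point in each of the three sets, with total circumference $12n$, where $n$ is the number of triples in the partition, such that along each triangle path the triangles that belong to the partition are either exactly the first, third, fifth, … or exactly the second, fourth, sixth, … ones. **Proposition.** For every instance of P3DM and every graph $G_{TP}$ constructed from it, there exists a pattern of alternating triangles in $G_{TP}$ if and only if the instance has answer YES. -/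

import Mathlib

/-- A simple graph is planar: its vertices can be placed at distinct points of the plane and its
edges drawn as simple arcs between their end points, such that no arc passes through a vertex in
its interior and no two arcs cross. -/
def IsPlanar {V : Type*} (G : SimpleGraph V) : Prop :=
  ∃ (pos : V → ℝ × ℝ) (arc : G.edgeSet → C(unitInterval, ℝ × ℝ)),
    Function.Injective pos ∧
    (∀ e, Function.Injective (arc e)) ∧
    (∀ e, s(arc e 0, arc e 1) = Sym2.map pos e.1) ∧
    (∀ e, ∀ t ∈ Set.Ioo (0 : unitInterval) 1, ∀ v, arc e t ≠ pos v) ∧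
    (∀ e f, e ≠ f → ∀ s ∈ Set.Ioo (0 : unitInterval) 1, ∀ t ∈ Set.Ioo (0 : unitInterval) 1,
      arc e s ≠ arc f t)

/-- The three elements of a triple, as elements of the disjoint union of `X`, `Y` and `Z`. -/
def member {X Y Z : Type*} (t : X × Y × Z) : Fin 3 → X ⊕ Y ⊕ Z :=
  ![Sum.inl t.1, Sum.inr (Sum.inl t.2.1), Sum.inr (Sum.inr t.2.2)]

/-- The graph induced by a set of triples: one vertex for each element and for each triple, and
an edge between each triple and each of its elements. -/
def inducedGraph {X Y Z : Type*} (T : Finset (X × Y × Z)) : SimpleGraph ((X ⊕ Y ⊕ Z) ⊕ T) :=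
  SimpleGraph.fromRel fun a b =>
    ∃ (t : T) (i : Fin 3), a = Sum.inl (member t.1 i) ∧ b = Sum.inr t

/-- An instance of planar three-dimensional matching. The types `X`, `Y`, `Z` are the three
pairwise disjoint sets. -/
structure P3DM (X Y Z : Type*) [Fintype X] [Fintype Y] [Fintype Z] where
  q : ℕ
  card_X : Fintype.card X = q
  card_Y : Fintype.card Y = q
  card_Z : Fintype.card Z = q
  T : Finset (X × Y × Z)
  occurs_le_three : ∀ e : X ⊕ Y ⊕ Z, {t | t ∈ T ∧ ∃ i, member t i = e}.ncard ≤ 3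
  planar : IsPlanar (inducedGraph T)

namespace P3DM

variable {X Y Z : Type*} [Fintype X] [Fintype Y] [Fintype Z]

/-- The instance has answer YES: some set of triples contains every element exactly once. -/
def IsYes (I : P3DM X Y Z) : Prop :=
  ∃ T' ⊆ I.T, ∀ e : X ⊕ Y ⊕ Z, ∃! t, t ∈ T' ∧ ∃ i, member t i = e

/-- The edges of the induced graph: `(t, i)` joins the triple `t` to its `i`-th element. -/
abbrev Edge (I : P3DM X Y Z) : Type _ := I.T × Fin 3

/-- The element at which an edge of the induced graph starts. -/
def Edge.elem {I : P3DM X Y Z} (p : I.Edge) : X ⊕ Y ⊕ Z := member p.1.1 p.2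

end P3DM

/-- A rectilinear layout of the induced graph: the vertices are placed at distinct points of the
integer grid, and every edge is drawn along horizontal and vertical unit segments of the grid,
without crossings. The edge `p` visits the grid points `route p 0`, …, `route p (len p)`. -/
structure RectilinearLayout {X Y Z : Type*} [Fintype X] [Fintype Y] [Fintype Z]
    (I : P3DM X Y Z) where
  pos : (X ⊕ Y ⊕ Z) ⊕ I.T → ℤ × ℤ
  pos_injective : Function.Injective pos
  len : I.Edge → ℕ
  route : I.Edge → ℕ → ℤ × ℤ
  route_zero : ∀ p, route p 0 = pos (Sum.inl p.elem)
  route_len : ∀ p, route p (len p) = pos (Sum.inr p.1)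
  route_step : ∀ p, ∀ j < len p,
    |(route p (j + 1)).1 - (route p j).1| + |(route p (j + 1)).2 - (route p j).2| = 1
  route_simple : ∀ p, ∀ j ≤ len p, ∀ j' ≤ len p, route p j = route p j' → j = j'
  route_avoids : ∀ p j, 0 < j → j < len p → ∀ v, route p j ≠ pos v
  route_disjoint : ∀ p p', p ≠ p' → ∀ j j', 0 < j → j < len p → 0 < j' → j' < len p' →
    route p j ≠ route p' j'

/-- `a`, `b`, `c` are the vertices of a 3-4-5 triangle with a horizontal leg `ab` and a vertical
leg `ac`. -/
def IsTriangle345 (a b c : ℤ × ℤ) : Prop :=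
  b.2 = a.2 ∧ c.1 = a.1 ∧
    ((|b.1 - a.1| = 3 ∧ |c.2 - a.2| = 4) ∨ (|b.1 - a.1| = 4 ∧ |c.2 - a.2| = 3))

/-- The points `a` and `b` are opposite corners of a vertically oriented 3 by 4 rectangle. -/
def IsVertical (a b : ℤ × ℤ) : Prop := |b.1 - a.1| = 3 ∧ |b.2 - a.2| = 4

/-- The points `a` and `b` are opposite corners of a horizontally oriented 4 by 3 rectangle. -/
def IsHorizontal (a b : ℤ × ℤ) : Prop := |b.1 - a.1| = 4 ∧ |b.2 - a.2| = 3

/-- The two corners, other than `a` and `b`, of the axis-parallel rectangle with opposite corners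
`a` and `b`. -/
def side (a b : ℤ × ℤ) : Bool → ℤ × ℤ
  | false => (a.1, b.2)
  | true => (b.1, a.2)

/-- A system of triangle paths. Every triple is replaced by a triple triangle, whose vertex
`tripleVertex t i` represents the `i`-th element of `t`. Every edge `p` is replaced by a path of
`pairs p` rectangular pairs of triangles. The `i`-th pair fills the rectangle with opposite
corners `joint p i` and `joint p (i + 1)`, and is cut into two triangles by the other diagonal. -/
structure TrianglePaths {X Y Z : Type*} [Fintype X] [Fintype Y] [Fintype Z]
    (I : P3DM X Y Z) where
  tripleVertex : I.T → Fin 3 → ℤ × ℤ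
  pairs : I.Edge → ℕ
  joint : I.Edge → ℕ → ℤ × ℤ

namespace TrianglePaths

variable {X Y Z : Type*} [Fintype X] [Fintype Y] [Fintype Z] {I : P3DM X Y Z}

/-- The `j`-th triangle, `j = 0, …, 2 * pairs p - 1`, of the path `p`, counted from the element
point; the triangles number `2 * i` and `2 * i + 1` form the `i`-th pair. They share the diagonal
between the two `side` corners; the third vertex of the former is `joint p i`, and the third
vertex of the latter is `joint p (i + 1)`. -/
def pathTriangle (D : TrianglePaths I) (p : I.Edge) (j : ℕ) : Fin 3 → ℤ × ℤ :=
  ![D.joint p ((j + 1) / 2),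
    side (D.joint p (j / 2)) (D.joint p (j / 2 + 1)) false,
    side (D.joint p (j / 2)) (D.joint p (j / 2 + 1)) true]

/-- The names of all triangles: those of the triangle paths, and the triple triangles. -/
abbrev Triangle (D : TrianglePaths I) : Type _ :=
  ((p : I.Edge) × Fin (2 * D.pairs p)) ⊕ I.T

/-- The vertices of a triangle. -/
def vertex (D : TrianglePaths I) : D.Triangle → Fin 3 → ℤ × ℤ
  | Sum.inl ⟨p, j⟩ => D.pathTriangle p j
  | Sum.inr t => D.tripleVertex t

/-- The vertex set of a triangle, as a set of points of the real plane. -/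
def vertexSet (D : TrianglePaths I) (a : D.Triangle) : Set (ℝ × ℝ) :=
  Set.range fun k => (((D.vertex a k).1 : ℝ), ((D.vertex a k).2 : ℝ))

end TrianglePaths

/-- A graph `G_TP` of an instance of planar three-dimensional matching, given by its triangles:
its vertices are the element points and the vertices of the triangles, its edges the sides of the
triangles. -/
structure TrianglePathGraph {X Y Z : Type*} [Fintype X] [Fintype Y] [Fintype Z]
    (I : P3DM X Y Z) extends TrianglePaths I where
  /-- the rectilinear layout; its coordinates get multiplied by 1000 -/
  layout : RectilinearLayout I
  /-- a vertex at `z` belongs to the set `P_c` of index `c = colour z` -/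
  colour : ℤ × ℤ → Fin 3
  /-- triple triangles are 3-4-5 triangles with axis-parallel legs -/
  triple_345 : ∀ t, ∃ σ : Equiv.Perm (Fin 3),
    IsTriangle345 (tripleVertex t (σ 0)) (tripleVertex t (σ 1)) (tripleVertex t (σ 2))
  /-- a triple triangle stands at the place of the vertex that it replaces -/
  triple_place : ∀ t i,
    |(tripleVertex t i).1 - 1000 * (layout.pos (Sum.inr t)).1| ≤ 4 ∧
    |(tripleVertex t i).2 - 1000 * (layout.pos (Sum.inr t)).2| ≤ 4
  two_le_pairs : ∀ p, 2 ≤ pairs p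
  /-- a path starts at the element point -/
  joint_zero : ∀ p, joint p 0 =
    (1000 * (layout.pos (Sum.inl p.elem)).1, 1000 * (layout.pos (Sum.inl p.elem)).2)
  /-- a path ends at the vertex of the triple triangle that represents the element -/
  joint_last : ∀ p, joint p (pairs p) = tripleVertex p.1 p.2
  /-- the first pair is vertical, the second one horizontal, the others are either -/
  first_vertical : ∀ p, IsVertical (joint p 0) (joint p 1)
  second_horizontal : ∀ p, IsHorizontal (joint p 1) (joint p 2)
  pair_345 : ∀ p, ∀ i < pairs p,
    IsVertical (joint p i) (joint p (i + 1)) ∨ IsHorizontal (joint p i) (joint p (i + 1))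
  /-- the three vertices of every triangle lie in three different sets -/
  colour_injective : ∀ a : toTrianglePaths.Triangle,
    Function.Injective fun k => colour (toTrianglePaths.vertex a k)
  /-- the triangles are pairwise different, and form a plane figure: two triangles meet in nothing
  but their common vertices, or a common side. In particular, consecutive pairs of a path are
  connected at one or two vertices, and the first two pairs at just one. -/
  vertexSet_injective : Function.Injective toTrianglePaths.vertexSet
  plane : ∀ a b : toTrianglePaths.Triangle,
    convexHull ℝ (toTrianglePaths.vertexSet a) ∩ convexHull ℝ (toTrianglePaths.vertexSet b) ⊆
      convexHull ℝ (toTrianglePaths.vertexSet a ∩ toTrianglePaths.vertexSet b)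

namespace TrianglePathGraph

variable {X Y Z : Type*} [Fintype X] [Fintype Y] [Fintype Z] {I : P3DM X Y Z}

/-- The points listed in the sets `P_1`, `P_2`, `P_3`, with repetition: the element points, the
vertices of the triple triangles, and the remaining vertices of the triangle paths, where a
vertex that is shared by two paths, or a side corner that is shared by two pairs of one path, is
listed once for each of them. -/
inductive Point (G : TrianglePathGraph I) where
  | elem (e : X ⊕ Y ⊕ Z)
  | triple (t : I.T) (i : Fin 3)
  /-- the place where pair number `i` and pair number `i + 1` are joined -/
  | joint (p : I.Edge) (i : Fin (G.pairs p - 1))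
  /-- one of the two corners on the common diagonal of pair number `i` -/
  | side (p : I.Edge) (i : Fin (G.pairs p)) (b : Bool)

/-- The coordinates of a point. -/
def coord (G : TrianglePathGraph I) : G.Point → ℤ × ℤ
  | .elem e => (1000 * (G.layout.pos (Sum.inl e)).1, 1000 * (G.layout.pos (Sum.inl e)).2)
  | .triple t i => G.tripleVertex t i
  | .joint p i => G.joint p (i + 1)
  | .side p i b => _root_.side (G.joint p i) (G.joint p (i + 1)) b

/-- The three sets `P_1`, `P_2`, `P_3`. -/
def P (G : TrianglePathGraph I) (c : Fin 3) : Set G.Point := {v | G.colour (G.coord v) = c}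

/-- The point at `joint p i`: the element point for `i = 0`, a vertex of the triple triangle for
`i = pairs p`. -/
def jointPoint (G : TrianglePathGraph I) (p : I.Edge) (i : ℕ) : G.Point :=
  if i = 0 then .elem p.elem
  else if h : i - 1 < G.pairs p - 1 then .joint p ⟨i - 1, h⟩
  else .triple p.1 p.2

/-- The `j`-th triangle of the path `p`, counted from the element point, as a set of points. -/
def pathTrianglePoints (G : TrianglePathGraph I) (p : I.Edge) (j : Fin (2 * G.pairs p)) :
    Set G.Point :=
  {G.jointPoint p ((j + 1) / 2), .side p ⟨j / 2, by omega⟩ false, .side p ⟨j / 2, by omega⟩ true}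

/-- Euclidean distance of two points. -/
noncomputable def eDist (G : TrianglePathGraph I) (v w : G.Point) : ℝ :=
  Real.sqrt ((((G.coord v).1 : ℝ) - (G.coord w).1) ^ 2 + (((G.coord v).2 : ℝ) - (G.coord w).2) ^ 2)

/-- The circumference of the triangle spanned by three points. -/
noncomputable def circumference (G : TrianglePathGraph I) (s : Fin 3 → G.Point) : ℝ :=
  G.eDist (s 0) (s 1) + G.eDist (s 0) (s 2) + G.eDist (s 1) (s 2)

/-- `M` is a partition of the points of `P_1`, `P_2`, `P_3` into triples with one point in each of
the three sets. -/
def IsPartition (G : TrianglePathGraph I) (M : Finset (Fin 3 → G.Point)) : Prop :=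
  (∀ s ∈ M, ∀ c, s c ∈ G.P c) ∧ ∀ v : G.Point, ∃! s, s ∈ M ∧ v ∈ Set.range s

/-- The `j`-th triangle of the path `p` is selected by `M`. -/
def Selected (G : TrianglePathGraph I) (M : Finset (Fin 3 → G.Point)) (p : I.Edge)
    (j : Fin (2 * G.pairs p)) : Prop :=
  ∃ s ∈ M, Set.range s = G.pathTrianglePoints p j

/-- `p` is an alternating triangle path under `M`: either the first, third, fifth, … triangles
are exactly those selected, or the second, fourth, sixth, … ones are (the numbers `j` start
at 0). -/
def IsAlternating (G : TrianglePathGraph I) (M : Finset (Fin 3 → G.Point)) (p : I.Edge) : Prop :=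
  (∀ j, G.Selected M p j ↔ Even (j : ℕ)) ∨ (∀ j, G.Selected M p j ↔ Odd (j : ℕ))

/-- There is a pattern of alternating triangles: a partition of the points into `n` triangles, one
vertex in each set, with total circumference `12 n`, under which every triangle path is
alternating. (As the triples of `M` partition each `P_c`, the number `n` is the common cardinality
of `P_1`, `P_2` and `P_3`.) -/
def HasAlternatingPattern (G : TrianglePathGraph I) : Prop :=
  ∃ M : Finset (Fin 3 → G.Point), G.IsPartition M ∧
    ∑ s ∈ M, G.circumference s = 12 * (M.card : ℝ) ∧ ∀ p, G.IsAlternating M p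

end TrianglePathGraph

/-! A triangle path is a switch. Its triangles are numbered from 0 to `2 * pairs p - 1`, and each of
its joints and side corners lies in one even and one odd triangle. So either parity class covers all
of these points exactly once. The even class also covers the element point and leaves the vertex of
the triple triangle free; the odd class does the opposite.

A matching gives a pattern: triples in `T'` get even paths and their triple triangle, all others get
odd paths only (`existsUnique_triangle_of_matching`). Every such triangle has circumference 12.

Conversely, alternation uses up all joints and side corners, so any other triple of the partition
consists of element points and triple vertices. Unless it is a triple triangle, it joins
neighbourhoods of two different layout vertices and is longer than 12. As the mean circumference is
12, this never happens (`range_eq_range_points`). The three paths at a triple then have equal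
parity, and the triples with even paths form the matching. -/

theorem member_injective {X Y Z : Type*} (t : X × Y × Z) : Function.Injective (member t) := by
  intro i j h
  fin_cases i <;> fin_cases j <;> simp_all [member]

theorem sqrt_add_sq_eq_five {x y : ℤ} (h : (|x| = 3 ∧ |y| = 4) ∨ (|x| = 4 ∧ |y| = 3)) :
    Real.sqrt ((x : ℝ) ^ 2 + (y : ℝ) ^ 2) = 5 := by
  have h' : x ^ 2 + y ^ 2 = 25 := by
    rw [← sq_abs x, ← sq_abs y]
    rcases h with ⟨h1, h2⟩ | ⟨h1, h2⟩ <;> rw [h1, h2] <;> norm_num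
  have h'' : (x : ℝ) ^ 2 + (y : ℝ) ^ 2 = 5 ^ 2 := by
    norm_num
    exact_mod_cast h'
  rw [h'', Real.sqrt_sq (by norm_num)]

/-! ### Triangles as triples of listed points -/

namespace TrianglePathGraph

variable {X Y Z : Type*} [Fintype X] [Fintype Y] [Fintype Z] {I : P3DM X Y Z}

/-- The listed points that are the vertices of a triangle. -/
def points (G : TrianglePathGraph I) : G.Triangle → Fin 3 → G.Point
  | Sum.inl ⟨p, j⟩ =>
    ![G.jointPoint p ((j + 1) / 2), .side p ⟨j / 2, by omega⟩ false, .side p ⟨j / 2, by omega⟩ true]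
  | Sum.inr t => fun i => .triple t i

theorem range_points_inl (G : TrianglePathGraph I) (p : I.Edge) (j : Fin (2 * G.pairs p)) :
    Set.range (G.points (Sum.inl ⟨p, j⟩)) = G.pathTrianglePoints p j := by
  ext v
  simp [points, pathTrianglePoints]
  tauto

/-- The bound on `i` is needed: past `pairs p`, `jointPoint` stays at the triple vertex, while
`G.joint` is unconstrained. -/
theorem coord_jointPoint (G : TrianglePathGraph I) (p : I.Edge) {i : ℕ} (hi : i ≤ G.pairs p) :
    G.coord (G.jointPoint p i) = G.joint p i := by
  have := G.two_le_pairs p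
  unfold jointPoint
  split_ifs with h0 h1
  · subst h0
    exact (G.joint_zero p).symm
  · show G.joint p (i - 1 + 1) = _
    rw [Nat.sub_add_cancel (by omega)]
  · obtain rfl : i = G.pairs p := by omega
    exact (G.joint_last p).symm

theorem coord_points (G : TrianglePathGraph I) (a : G.Triangle) (k : Fin 3) :
    G.coord (G.points a k) = G.vertex a k := by
  rcases a with ⟨p, j⟩ | t
  · fin_cases k
    · exact G.coord_jointPoint p (by omega)
    · rfl
    · rfl
  · rfl

theorem colour_coord_injective (G : TrianglePathGraph I) (a : G.Triangle) :
    Function.Injective fun k => G.colour (G.coord (G.points a k)) := by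
  simpa only [coord_points] using G.colour_injective a

theorem points_injective (G : TrianglePathGraph I) (a : G.Triangle) :
    Function.Injective (G.points a) := fun _ _ h =>
  G.colour_coord_injective a (congrArg (fun v => G.colour (G.coord v)) h)

/-! ### Incidence of listed points and triangles -/

section Membership

variable (G : TrianglePathGraph I)

theorem jointPoint_eq_elem {p : I.Edge} {i : ℕ} {e : X ⊕ Y ⊕ Z} :
    G.jointPoint p i = .elem e ↔ i = 0 ∧ p.elem = e := by
  unfold jointPoint
  split_ifs <;> simp_all

theorem jointPoint_ne_side {p q : I.Edge} {i : ℕ} {k : Fin (G.pairs q)} {b : Bool} :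
    G.jointPoint p i ≠ .side q k b := by
  unfold jointPoint
  split_ifs <;> simp

theorem jointPoint_eq_triple {p : I.Edge} {i : ℕ} {t : I.T} {k : Fin 3} :
    G.jointPoint p i = .triple t k ↔ G.pairs p ≤ i ∧ p = (t, k) := by
  have := G.two_le_pairs p
  unfold jointPoint
  split_ifs with h0 h1
  · simp
    omega
  · simp
    omega
  · have : G.pairs p ≤ i := by omega
    simp [this, Prod.ext_iff]

theorem jointPoint_eq_joint {p q : I.Edge} {i : ℕ} {k : Fin (G.pairs q - 1)} :
    G.jointPoint p i = .joint q k ↔ p = q ∧ i = k + 1 := by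
  have := k.isLt
  unfold jointPoint
  split_ifs with h0 h1
  · simp
    omega
  · constructor
    · intro h
      injection h with h2 h3
      subst h2
      rw [heq_eq_eq] at h3
      have := congrArg Fin.val h3
      simp at this
      exact ⟨rfl, by omega⟩
    · rintro ⟨rfl, rfl⟩
      rfl
  · simp
    rintro rfl
    omega

theorem jointPoint_inj {p : I.Edge} {i j : ℕ} (hi : i ≤ G.pairs p) (hj : j ≤ G.pairs p)
    (h : G.jointPoint p i = G.jointPoint p j) : i = j := by
  have := G.two_le_pairs p
  by_cases h0 : i = 0
  · rw [(G.jointPoint_eq_elem (p := p) (e := p.elem)).2 ⟨h0, rfl⟩, eq_comm,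
      jointPoint_eq_elem] at h
    omega
  by_cases h1 : i = G.pairs p
  · rw [(G.jointPoint_eq_triple (p := p) (t := p.1) (k := p.2)).2 ⟨h1.ge, rfl⟩, eq_comm,
      jointPoint_eq_triple] at h
    omega
  · rw [(G.jointPoint_eq_joint (p := p) (k := ⟨i - 1, by omega⟩)).2
      ⟨rfl, by simp; omega⟩, eq_comm, jointPoint_eq_joint] at h
    have := h.2
    simp at this
    omega

theorem mem_pathTrianglePoints {v : G.Point} {p : I.Edge} {j : Fin (2 * G.pairs p)} :
    v ∈ G.pathTrianglePoints p j ↔ G.jointPoint p ((j + 1) / 2) = v ∨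
      ∃ b, v = .side p ⟨j / 2, by omega⟩ b := by
  simp [pathTrianglePoints, eq_comm]

theorem elem_mem_pathTrianglePoints {e : X ⊕ Y ⊕ Z} {p : I.Edge} {j : Fin (2 * G.pairs p)} :
    .elem e ∈ G.pathTrianglePoints p j ↔ (j : ℕ) = 0 ∧ p.elem = e := by
  simp only [mem_pathTrianglePoints, jointPoint_eq_elem, reduceCtorEq, exists_false, or_false]
  have : ((j : ℕ) + 1) / 2 = 0 ↔ (j : ℕ) = 0 := by omega
  rw [this]

/-- The only path triangle at a triple vertex is the last one, whose number is odd, whereas the one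
at an element point is number 0. -/
theorem triple_mem_pathTrianglePoints {t : I.T} {i : Fin 3} {p : I.Edge}
    {j : Fin (2 * G.pairs p)} :
    .triple t i ∈ G.pathTrianglePoints p j ↔ (j : ℕ) = 2 * G.pairs p - 1 ∧ p = (t, i) := by
  simp only [mem_pathTrianglePoints, jointPoint_eq_triple, reduceCtorEq, exists_false, or_false]
  have : G.pairs p ≤ ((j : ℕ) + 1) / 2 ↔ (j : ℕ) = 2 * G.pairs p - 1 := by omega
  rw [this]

/-- The two numbers are consecutive, so each parity class covers the joint exactly once. The same
holds for side corners below. -/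
theorem joint_mem_pathTrianglePoints {q : I.Edge} {k : Fin (G.pairs q - 1)} {p : I.Edge}
    {j : Fin (2 * G.pairs p)} :
    .joint q k ∈ G.pathTrianglePoints p j ↔
      p = q ∧ ((j : ℕ) = 2 * k + 1 ∨ (j : ℕ) = 2 * k + 2) := by
  simp only [mem_pathTrianglePoints, jointPoint_eq_joint, reduceCtorEq, exists_false, or_false]
  have : ((j : ℕ) + 1) / 2 = k + 1 ↔ (j : ℕ) = 2 * k + 1 ∨ (j : ℕ) = 2 * k + 2 := by omega
  rw [this]

theorem side_mem_pathTrianglePoints {q : I.Edge} {k : Fin (G.pairs q)} {b : Bool} {p : I.Edge}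
    {j : Fin (2 * G.pairs p)} :
    .side q k b ∈ G.pathTrianglePoints p j ↔
      p = q ∧ ((j : ℕ) = 2 * k ∨ (j : ℕ) = 2 * k + 1) := by
  simp only [mem_pathTrianglePoints, jointPoint_ne_side, false_or]
  constructor
  · rintro ⟨b', h⟩
    injection h with h1 h2 h3
    subst h1
    rw [heq_eq_eq] at h2
    have := congrArg Fin.val h2
    simp at this
    exact ⟨rfl, by omega⟩
  · rintro ⟨rfl, h⟩
    refine ⟨b, ?_⟩
    congr 1
    apply Fin.ext
    simp only
    omega

theorem mem_range_triple {v : G.Point} {t : I.T} :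
    v ∈ Set.range (G.points (Sum.inr t)) ↔ ∃ i, v = .triple t i := by
  simp [points, eq_comm]

/-- A side corner reveals the path and the pair, and the joint tells the two triangles of a pair
apart. No path triangle contains two vertices of a triple triangle. -/
theorem range_points_injective : Function.Injective fun a => Set.range (G.points a) := by
  rintro (⟨p, j⟩ | t) b h
  · simp only [range_points_inl] at h
    have hs : Point.side p ⟨j / 2, by omega⟩ false ∈ G.pathTrianglePoints p j :=
      G.side_mem_pathTrianglePoints.2 ⟨rfl, by simp; omega⟩
    rcases b with ⟨q, k⟩ | t
    · rw [range_points_inl] at h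
      rw [h, side_mem_pathTrianglePoints] at hs
      obtain ⟨rfl, hk⟩ := hs
      have hj : G.jointPoint q ((j + 1) / 2) ∈ G.pathTrianglePoints q j :=
        G.mem_pathTrianglePoints.2 (Or.inl rfl)
      rw [h, mem_pathTrianglePoints] at hj
      have hj := hj.resolve_right fun ⟨_, hb⟩ => G.jointPoint_ne_side hb
      have := G.jointPoint_inj (by omega) (by omega) hj
      simp at hk
      obtain rfl : j = k := by omega
      rfl
    · simp [h, points] at hs
  · change Set.range (G.points (Sum.inr t)) = Set.range (G.points b) at h
    have h0 : Point.triple t 0 ∈ Set.range (G.points b) := h ▸ G.mem_range_triple.2 ⟨0, rfl⟩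
    have h1 : Point.triple t 1 ∈ Set.range (G.points b) := h ▸ G.mem_range_triple.2 ⟨1, rfl⟩
    rcases b with ⟨q, k⟩ | t'
    · rw [range_points_inl, triple_mem_pathTrianglePoints] at h0 h1
      have := h0.2.symm.trans h1.2
      simp at this
    · obtain ⟨_, h0⟩ := G.mem_range_triple.1 h0
      injection h0 with h0
      rw [h0]

end Membership

/-! ### Circumferences -/

theorem eDist_comm (G : TrianglePathGraph I) (v w : G.Point) : G.eDist v w = G.eDist w v := by
  unfold eDist
  congr 1
  ring

theorem eDist_nonneg (G : TrianglePathGraph I) (v w : G.Point) : 0 ≤ G.eDist v w :=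
  Real.sqrt_nonneg _

theorem circumference_comp_perm (G : TrianglePathGraph I) (s : Fin 3 → G.Point)
    (σ : Equiv.Perm (Fin 3)) : G.circumference (s ∘ σ) = G.circumference s := by
  -- The sum over all ordered pairs is visibly invariant under permutations.
  have key : ∀ r : Fin 3 → G.Point,
      2 * G.circumference r = ∑ i, ∑ j, G.eDist (r i) (r j) := by
    intro r
    have h0 : ∀ v, G.eDist v v = 0 := fun v => by simp [eDist]
    simp only [Fin.sum_univ_three, h0, circumference]
    rw [G.eDist_comm (r 1) (r 0), G.eDist_comm (r 2) (r 0), G.eDist_comm (r 2) (r 1)]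
    ring
  have h : ∑ i, ∑ j, G.eDist ((s ∘ σ) i) ((s ∘ σ) j) = ∑ i, ∑ j, G.eDist (s i) (s j) := by
    rw [← Equiv.sum_comp σ fun i => ∑ j, G.eDist (s i) (s j)]
    refine Finset.sum_congr rfl fun i _ => ?_
    exact Equiv.sum_comp σ fun j => G.eDist (s (σ i)) (s j)
  linarith [key s, key (s ∘ σ)]

theorem circumference_eq_of_range_eq (G : TrianglePathGraph I) {s r : Fin 3 → G.Point}
    (hs : Function.Injective s) (hr : Function.Injective r) (h : Set.range s = Set.range r) :
    G.circumference s = G.circumference r := by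
  let σ : Equiv.Perm (Fin 3) :=
    (Equiv.ofInjective s hs).trans ((Equiv.setCongr h).trans (Equiv.ofInjective r hr).symm)
  have : s = r ∘ σ := by
    funext i
    simp only [σ, Function.comp, Equiv.trans_apply, Equiv.apply_ofInjective_symm]
    rfl
  rw [this, circumference_comp_perm]

theorem circumference_of_isTriangle345 (G : TrianglePathGraph I) {s : Fin 3 → G.Point}
    (h : IsTriangle345 (G.coord (s 0)) (G.coord (s 1)) (G.coord (s 2))) :
    G.circumference s = 12 := by
  obtain ⟨h1, h2, h3⟩ := h
  have h5 : G.eDist (s 1) (s 2) = 5 := by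
    rw [← sqrt_add_sq_eq_five h3, eDist]
    congr 1
    rw [h1, h2]
    push_cast
    ring
  have ha : G.eDist (s 0) (s 1) = |(((G.coord (s 1)).1 - (G.coord (s 0)).1 : ℤ) : ℝ)| := by
    rw [eDist, ← Real.sqrt_sq_eq_abs, h1]
    congr 1
    push_cast
    ring
  have hb : G.eDist (s 0) (s 2) = |(((G.coord (s 2)).2 - (G.coord (s 0)).2 : ℤ) : ℝ)| := by
    rw [eDist, ← Real.sqrt_sq_eq_abs, h2]
    congr 1
    push_cast
    ring
  rw [circumference, h5, ha, hb]
  rcases h3 with ⟨h3, h4⟩ | ⟨h3, h4⟩ <;> rw [← Int.cast_abs, ← Int.cast_abs, h3, h4] <;> norm_num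

theorem circumference_points (G : TrianglePathGraph I) (a : G.Triangle) :
    G.circumference (G.points a) = 12 := by
  rcases a with ⟨p, j⟩ | t
  · have hpair := G.pair_345 p (j / 2) (by omega)
    have hj : ((j : ℕ) + 1) / 2 = j / 2 ∨ ((j : ℕ) + 1) / 2 = j / 2 + 1 := by omega
    unfold IsVertical IsHorizontal at hpair
    rcases hj with hj | hj
    -- In the first triangle of a pair the horizontal leg ends at the `true` corner, so the side
    -- corners must be swapped; in the second triangle they are already in order.
    · rw [← G.circumference_comp_perm _ (Equiv.swap 1 2)]
      apply circumference_of_isTriangle345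
      simp only [Function.comp, coord_points, TrianglePaths.vertex, TrianglePaths.pathTriangle, hj]
      simpa [IsTriangle345, side, Equiv.swap_apply_def] using hpair
    · apply circumference_of_isTriangle345
      simp only [coord_points, TrianglePaths.vertex, TrianglePaths.pathTriangle, hj]
      simpa [IsTriangle345, side, abs_sub_comm] using hpair
  · obtain ⟨σ, hσ⟩ := G.triple_345 t
    rw [← G.circumference_comp_perm _ σ]
    exact G.circumference_of_isTriangle345 hσ

/-- The vertices of a triangle, listed by colour. -/
noncomputable def sorted (G : TrianglePathGraph I) (a : G.Triangle) : Fin 3 → G.Point :=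
  G.points a ∘ (Equiv.ofBijective _
    (Finite.injective_iff_bijective.1 (G.colour_coord_injective a))).symm

theorem sorted_mem_P (G : TrianglePathGraph I) (a : G.Triangle) (c : Fin 3) :
    G.sorted a c ∈ G.P c :=
  (Equiv.ofBijective _
    (Finite.injective_iff_bijective.1 (G.colour_coord_injective a))).apply_symm_apply c

theorem range_sorted (G : TrianglePathGraph I) (a : G.Triangle) :
    Set.range (G.sorted a) = Set.range (G.points a) := by
  rw [sorted, Set.range_comp, Equiv.range_eq_univ, Set.image_univ]

theorem circumference_sorted (G : TrianglePathGraph I) (a : G.Triangle) :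
    G.circumference (G.sorted a) = 12 := by
  rw [sorted, circumference_comp_perm, circumference_points]

/-! ### From a matching to a pattern -/

open Classical in
-- `S` selects even path triangles at chosen triples and odd ones elsewhere. An element point is
-- covered through its unique chosen triple; a triple vertex by its triple triangle if the triple is
-- chosen, and otherwise by the last triangle of its path.
theorem existsUnique_triangle_of_matching (G : TrianglePathGraph I) {T' : Finset (X × Y × Z)}
    (hT : T' ⊆ I.T) (hT' : ∀ e : X ⊕ Y ⊕ Z, ∃! t, t ∈ T' ∧ ∃ i, member t i = e)
    (S : G.Triangle → Prop) (hSl : ∀ p j, S (Sum.inl ⟨p, j⟩) ↔ (p.1.1 ∈ T' ↔ Even (j : ℕ)))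
    (hSr : ∀ t, S (Sum.inr t) ↔ t.1 ∈ T') (v : G.Point) :
    ∃! a, S a ∧ v ∈ Set.range (G.points a) := by
  cases v with
  | elem e =>
    obtain ⟨t, ⟨ht, i, hi⟩, huniq⟩ := hT' e
    have h2 := G.two_le_pairs (⟨t, hT ht⟩, i)
    refine ⟨Sum.inl ⟨(⟨t, hT ht⟩, i), ⟨0, by omega⟩⟩, ⟨?_, ?_⟩, ?_⟩
    · rw [hSl]
      simp [ht]
    · rw [range_points_inl, elem_mem_pathTrianglePoints]
      exact ⟨rfl, hi⟩
    · rintro (⟨⟨t', i'⟩, j⟩ | t') ⟨hS, hv⟩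
      · rw [range_points_inl, elem_mem_pathTrianglePoints] at hv
        obtain ⟨hj, he⟩ := hv
        rw [hSl, hj] at hS
        have ht' : t'.1 ∈ T' := by simpa using hS
        have := huniq t'.1 ⟨ht', i', he⟩
        obtain rfl : t' = ⟨t, hT ht⟩ := Subtype.ext this
        obtain rfl : i' = i := member_injective t (Eq.trans he hi.symm)
        congr 2
        exact Fin.ext hj
      · simp [points] at hv
  | triple t i =>
    have h2 := G.two_le_pairs (t, i)
    by_cases ht : t.1 ∈ T'
    · refine ⟨Sum.inr t, ⟨(hSr t).2 ht, G.mem_range_triple.2 ⟨i, rfl⟩⟩, ?_⟩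
      rintro (⟨p, j⟩ | t') ⟨hS, hv⟩
      · rw [range_points_inl, triple_mem_pathTrianglePoints] at hv
        obtain ⟨hj, rfl⟩ := hv
        rw [hSl, Nat.even_iff] at hS
        simp [ht] at hS
        omega
      · simp [points] at hv
        rw [hv]
    · refine ⟨Sum.inl ⟨(t, i), ⟨2 * G.pairs (t, i) - 1, by omega⟩⟩, ⟨?_, ?_⟩, ?_⟩
      · rw [hSl, Nat.even_iff]
        simp [ht]
        omega
      · rw [range_points_inl, triple_mem_pathTrianglePoints]
        exact ⟨rfl, rfl⟩
      · rintro (⟨p, j⟩ | t') ⟨hS, hv⟩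
        · rw [range_points_inl, triple_mem_pathTrianglePoints] at hv
          obtain ⟨hj, rfl⟩ := hv
          congr 2
          exact Fin.ext hj
        · simp [points] at hv
          rw [hSr, hv] at hS
          exact absurd hS ht
  | joint p k =>
    have hk := k.isLt
    by_cases ht : p.1.1 ∈ T'
    all_goals
      refine ⟨Sum.inl ⟨p, ⟨if p.1.1 ∈ T' then 2 * k + 2 else 2 * k + 1, by split_ifs; omega⟩⟩,
        ⟨?_, ?_⟩, ?_⟩
      · rw [hSl, Nat.even_iff]
        simp [ht]
        try omega
      · rw [range_points_inl, joint_mem_pathTrianglePoints]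
        simp [ht]
      · rintro (⟨q, j⟩ | t') ⟨hS, hv⟩
        · rw [range_points_inl, joint_mem_pathTrianglePoints] at hv
          obtain ⟨rfl, hj⟩ := hv
          rw [hSl, Nat.even_iff] at hS
          simp [ht] at hS
          congr 2
          apply Fin.ext
          simp [ht]
          omega
        · simp [points] at hv
  | side p k b =>
    have hk := k.isLt
    by_cases ht : p.1.1 ∈ T'
    all_goals
      refine ⟨Sum.inl ⟨p, ⟨if p.1.1 ∈ T' then 2 * k else 2 * k + 1, by split_ifs; omega⟩⟩,
        ⟨?_, ?_⟩, ?_⟩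
      · rw [hSl, Nat.even_iff]
        simp [ht]
        try omega
      · rw [range_points_inl, side_mem_pathTrianglePoints]
        simp [ht]
      · rintro (⟨q, j⟩ | t') ⟨hS, hv⟩
        · rw [range_points_inl, side_mem_pathTrianglePoints] at hv
          obtain ⟨rfl, hj⟩ := hv
          rw [hSl, Nat.even_iff] at hS
          simp [ht] at hS
          congr 2
          apply Fin.ext
          simp [ht]
          omega
        · simp [points] at hv

open Classical in
theorem hasAlternatingPattern_of_isYes (G : TrianglePathGraph I) (h : I.IsYes) :
    G.HasAlternatingPattern := by
  obtain ⟨T', hT, hT'⟩ := h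
  let S : G.Triangle → Prop := fun a => match a with
    | Sum.inl ⟨p, j⟩ => p.1.1 ∈ T' ↔ Even (j : ℕ)
    | Sum.inr t => t.1 ∈ T'
  have hS := G.existsUnique_triangle_of_matching hT hT' S (fun _ _ => Iff.rfl) fun _ => Iff.rfl
  have hsel : ∀ p j, G.Selected ((Finset.univ.filter S).image G.sorted) p j ↔
      (p.1.1 ∈ T' ↔ Even (j : ℕ)) := by
    intro p j
    constructor
    · rintro ⟨s, hs, hr⟩
      obtain ⟨a, ha, rfl⟩ := Finset.mem_image.1 hs
      rw [range_sorted, ← range_points_inl] at hr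
      obtain rfl := G.range_points_injective hr
      exact (Finset.mem_filter.1 ha).2
    · intro hj
      refine ⟨G.sorted (Sum.inl ⟨p, j⟩), Finset.mem_image_of_mem _ (by simpa using hj), ?_⟩
      rw [range_sorted, range_points_inl]
  refine ⟨(Finset.univ.filter S).image G.sorted, ⟨?_, ?_⟩, ?_, ?_⟩
  · intro s hs
    obtain ⟨a, _, rfl⟩ := Finset.mem_image.1 hs
    exact G.sorted_mem_P a
  · intro v
    obtain ⟨a, ⟨ha, hv⟩, huniq⟩ := hS v
    refine ⟨G.sorted a, ⟨Finset.mem_image_of_mem _ (by simpa using ha), by rwa [range_sorted]⟩, ?_⟩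
    rintro s ⟨hs, hvs⟩
    obtain ⟨b, hb, rfl⟩ := Finset.mem_image.1 hs
    rw [range_sorted] at hvs
    rw [huniq b ⟨(Finset.mem_filter.1 hb).2, hvs⟩]
  · rw [Finset.sum_congr rfl (g := fun _ => (12 : ℝ))]
    · rw [Finset.sum_const, nsmul_eq_mul, mul_comm]
    · intro s hs
      obtain ⟨a, _, rfl⟩ := Finset.mem_image.1 hs
      exact G.circumference_sorted a
  · intro p
    by_cases ht : p.1.1 ∈ T'
    · exact Or.inl fun j => by simp [hsel, ht]
    · exact Or.inr fun j => by simp [hsel, ht]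

/-! ### From a pattern to a matching -/

theorem injective_of_mem_P (G : TrianglePathGraph I) {s : Fin 3 → G.Point}
    (hs : ∀ c, s c ∈ G.P c) : Function.Injective s := fun c d h => by
  have hc : G.colour (G.coord (s c)) = c := hs c
  have hd : G.colour (G.coord (s d)) = d := hs d
  rw [← hc, ← hd, h]

/-- Points that belong to different vertices of the layout are far apart. -/
theorem twelve_lt_eDist (G : TrianglePathGraph I) {v w : G.Point} {a b : (X ⊕ Y ⊕ Z) ⊕ I.T}
    (hab : a ≠ b)
    (hv : |(G.coord v).1 - 1000 * (G.layout.pos a).1| ≤ 4 ∧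
      |(G.coord v).2 - 1000 * (G.layout.pos a).2| ≤ 4)
    (hw : |(G.coord w).1 - 1000 * (G.layout.pos b).1| ≤ 4 ∧
      |(G.coord w).2 - 1000 * (G.layout.pos b).2| ≤ 4) : 12 < G.eDist v w := by
  have hne : (G.layout.pos a).1 ≠ (G.layout.pos b).1 ∨
      (G.layout.pos a).2 ≠ (G.layout.pos b).2 := by
    by_contra hc
    push Not at hc
    exact hab (G.layout.pos_injective (Prod.ext hc.1 hc.2))
  simp only [abs_le] at hv hw
  -- In a coordinate where the layout positions differ, the gap is at least 1000 - 4 - 4, far above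
  -- 12.
  have key : ∀ x : ℤ, 12 < x ∨ x < -12 → (144 : ℤ) < x ^ 2 := by
    rintro x (h | h) <;> nlinarith
  have h144 : (144 : ℤ) < ((G.coord v).1 - (G.coord w).1) ^ 2 +
      ((G.coord v).2 - (G.coord w).2) ^ 2 := by
    rcases hne with h | h
    · have := key ((G.coord v).1 - (G.coord w).1) (by omega)
      nlinarith [sq_nonneg ((G.coord v).2 - (G.coord w).2)]
    · have := key ((G.coord v).2 - (G.coord w).2) (by omega)
      nlinarith [sq_nonneg ((G.coord v).1 - (G.coord w).1)]
  rw [eDist]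
  apply Real.lt_sqrt_of_sq_lt
  norm_num
  exact_mod_cast h144

theorem twelve_lt_circumference (G : TrianglePathGraph I) {s : Fin 3 → G.Point} {c d : Fin 3}
    (hcd : 12 < G.eDist (s c) (s d)) : 12 < G.circumference s := by
  have h0 : ∀ v, G.eDist v v = 0 := fun v => by simp [eDist]
  have h1 := G.eDist_nonneg (s 0) (s 1)
  have h2 := G.eDist_nonneg (s 0) (s 2)
  have h3 := G.eDist_nonneg (s 1) (s 2)
  have e1 := G.eDist_comm (s 0) (s 1)
  have e2 := G.eDist_comm (s 0) (s 2)
  have e3 := G.eDist_comm (s 1) (s 2)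
  unfold circumference
  fin_cases c <;> fin_cases d <;> simp [h0] at hcd <;> linarith

/-- Three points away from the triangle paths have circumference greater than 12, unless they form
a triple triangle. -/
theorem eq_triple_or_twelve_lt (G : TrianglePathGraph I) {s : Fin 3 → G.Point}
    (hs : Function.Injective s)
    (h : ∀ c, (∃ e, s c = .elem e) ∨ ∃ t i, s c = .triple t i) :
    (∃ t, Set.range s = Set.range (G.points (Sum.inr t))) ∨ 12 < G.circumference s := by
  have hbase : ∀ c, ∃ a : (X ⊕ Y ⊕ Z) ⊕ I.T,
      (∀ e, a = Sum.inl e → s c = .elem e) ∧ (∀ t, a = Sum.inr t → ∃ i, s c = .triple t i) ∧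
      |(G.coord (s c)).1 - 1000 * (G.layout.pos a).1| ≤ 4 ∧
      |(G.coord (s c)).2 - 1000 * (G.layout.pos a).2| ≤ 4 := by
    intro c
    rcases h c with ⟨e, he⟩ | ⟨t, i, ht⟩
    · refine ⟨Sum.inl e, by simp [he], by simp, ?_⟩
      simp [he, coord]
    · refine ⟨Sum.inr t, by simp, by simp [ht], ?_⟩
      rw [ht]
      exact G.triple_place t i
  choose a hae hat hpos using hbase
  -- With a common layout vertex, an element is impossible, since the three points are distinct; a
  -- triple forces all three of its vertices.
  by_cases hall : ∀ c d, a c = a d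
  · left
    cases ha : a 0 with
    | inl e =>
      have := hs ((hae 0 e ha).trans (hae 1 e ((hall 1 0).trans ha)).symm)
      simp at this
    | inr t =>
      choose f hf using fun c => hat c t ((hall c 0).trans ha)
      have hinj : Function.Injective f := fun c d hcd => hs (by rw [hf, hf, hcd])
      refine ⟨t, ?_⟩
      have : s = G.points (Sum.inr t) ∘ f := funext hf
      rw [this, (Finite.injective_iff_surjective.1 hinj).range_comp]
  · push Not at hall
    obtain ⟨c, d, hcd⟩ := hall
    exact Or.inr (G.twelve_lt_circumference (G.twelve_lt_eDist hcd (hpos c) (hpos d)))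

/-- A triple of the partition that meets a selected path triangle equals it, by disjointness. By
alternation, every joint and side corner lies in a selected triangle, so `eq_triple_or_twelve_lt`
applies to the remaining triples. -/
theorem range_eq_range_points (G : TrianglePathGraph I) {M : Finset (Fin 3 → G.Point)}
    (hM : G.IsPartition M) (hsum : ∑ s ∈ M, G.circumference s = 12 * (M.card : ℝ))
    (halt : ∀ p, G.IsAlternating M p) {s : Fin 3 → G.Point} (hs : s ∈ M) :
    ∃ a, Set.range s = Set.range (G.points a) := by
  have huniq : ∀ {r r' : Fin 3 → G.Point} {v}, r ∈ M → r' ∈ M → v ∈ Set.range r →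
      v ∈ Set.range r' → r = r' := fun h1 h2 h3 h4 => (hM.2 _).unique ⟨h1, h3⟩ ⟨h2, h4⟩
  have main : ∀ r ∈ M, (∃ a, Set.range r = Set.range (G.points a)) ∨ 12 < G.circumference r := by
    intro r hr
    by_cases hpath : ∃ p j, G.Selected M p j ∧ ∃ c, r c ∈ G.pathTrianglePoints p j
    · obtain ⟨p, j, ⟨r', hr', hrange⟩, c, hc⟩ := hpath
      obtain rfl := huniq hr hr' ⟨c, rfl⟩ (hrange ▸ hc)
      exact Or.inl ⟨Sum.inl ⟨p, j⟩, by rw [hrange, range_points_inl]⟩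
    · push Not at hpath
      refine (G.eq_triple_or_twelve_lt (G.injective_of_mem_P (hM.1 r hr)) fun c => ?_).imp_left
        fun ⟨t, ht⟩ => ⟨_, ht⟩
      cases hc : r c with
      | elem e => exact Or.inl ⟨e, rfl⟩
      | triple t i => exact Or.inr ⟨t, i, rfl⟩
      | joint p k =>
        have hk := k.isLt
        exfalso
        rcases halt p with h | h
        · refine hpath p ⟨2 * k + 2, by omega⟩ ((h _).2 (by simp [parity_simps])) c ?_
          rw [hc, joint_mem_pathTrianglePoints]
          simp
        · refine hpath p ⟨2 * k + 1, by omega⟩ ((h _).2 (by simp)) c ?_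
          rw [hc, joint_mem_pathTrianglePoints]
          simp
      | side p k b =>
        have hk := k.isLt
        exfalso
        rcases halt p with h | h
        · refine hpath p ⟨2 * k, by omega⟩ ((h _).2 (by simp)) c ?_
          rw [hc, side_mem_pathTrianglePoints]
          simp
        · refine hpath p ⟨2 * k + 1, by omega⟩ ((h _).2 (by simp)) c ?_
          rw [hc, side_mem_pathTrianglePoints]
          simp
  have hle : ∀ r ∈ M, (12 : ℝ) ≤ G.circumference r := by
    intro r hr
    rcases main r hr with ⟨a, ha⟩ | h
    · rw [G.circumference_eq_of_range_eq (G.injective_of_mem_P (hM.1 r hr))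
        (G.points_injective a) ha, circumference_points]
    · exact h.le
  -- All circumferences are at least 12 and their sum is 12 times their number, so each equals 12.
  have heq := (Finset.sum_eq_sum_iff_of_le hle).1
    (by rw [hsum, Finset.sum_const, nsmul_eq_mul, mul_comm]) s hs
  exact (main s hs).resolve_right fun h => h.ne heq

open Classical in
theorem isYes_of_hasAlternatingPattern (G : TrianglePathGraph I) (h : G.HasAlternatingPattern) :
    I.IsYes := by
  obtain ⟨M, hM, hsum, halt⟩ := h
  have hrange : ∀ s ∈ M, ∃ a, Set.range s = Set.range (G.points a) := fun s hs =>
    G.range_eq_range_points hM hsum halt hs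
  have huniq : ∀ {r r' : Fin 3 → G.Point} {v}, r ∈ M → r' ∈ M → v ∈ Set.range r →
      v ∈ Set.range r' → r = r' := fun h1 h2 h3 h4 => (hM.2 _).unique ⟨h1, h3⟩ ⟨h2, h4⟩
  let E : I.Edge → Prop := fun p => ∀ j, G.Selected M p j ↔ Even (j : ℕ)
  have hpos : ∀ p, 0 < 2 * G.pairs p := fun p => by
    have := G.two_le_pairs p
    omega
  -- the paths that end at one triple triangle have the same parity
  have hE : ∀ t i i', E (t, i) → E (t, i') := by
    intro t i i' hi
    refine (halt (t, i')).resolve_right fun hi' => ?_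
    have hp := hpos (t, i)
    have hp' := hpos (t, i')
    -- Path `i` being even, its last triangle is not selected, so the triple triangle covers vertex
    -- `i`. If path `i'` were odd, its last triangle would overlap the triple triangle at vertex
    -- `i'`.
    obtain ⟨s, ⟨hs, hv⟩, -⟩ := hM.2 (.triple t i)
    obtain ⟨a, ha⟩ := hrange s hs
    rw [ha] at hv
    rcases a with ⟨p, j⟩ | t'
    · rw [range_points_inl, triple_mem_pathTrianglePoints] at hv
      obtain ⟨hj, rfl⟩ := hv
      have := (hi j).1 ⟨s, hs, by rw [ha, range_points_inl]⟩
      rw [Nat.even_iff] at this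
      omega
    · obtain rfl : t' = t := by
        simpa [points] using hv
      obtain ⟨s', hs', hr'⟩ := (hi' ⟨2 * G.pairs (t', i') - 1, by omega⟩).2
        (by rw [Nat.odd_iff]; simp only; omega)
      have hmem : Point.triple t' i' ∈ Set.range s' := by
        rw [hr', triple_mem_pathTrianglePoints]
        exact ⟨rfl, rfl⟩
      obtain rfl := huniq hs hs' (ha ▸ G.mem_range_triple.2 ⟨i', rfl⟩) hmem
      rw [ha, ← range_points_inl] at hr'
      exact Sum.inr_ne_inl (G.range_points_injective hr')
  -- Index 0 is an arbitrary representative: by `hE` all three paths of a triple agree.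
  refine ⟨I.T.filter fun t => ∃ ht : t ∈ I.T, E (⟨t, ht⟩, 0), Finset.filter_subset _ _, ?_⟩
  intro e
  obtain ⟨s, ⟨hs, hv⟩, -⟩ := hM.2 (.elem e)
  obtain ⟨a, ha⟩ := hrange s hs
  have hv' := hv
  rw [ha] at hv'
  rcases a with ⟨⟨t, i⟩, j⟩ | t'
  · rw [range_points_inl, elem_mem_pathTrianglePoints] at hv'
    obtain ⟨hj, he⟩ := hv'
    have hEp : E (t, i) := by
      refine (halt (t, i)).resolve_right fun ho => ?_
      have := (ho j).1 ⟨s, hs, by rw [ha, range_points_inl]⟩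
      simp [hj] at this
    refine ⟨t.1, ⟨Finset.mem_filter.2 ⟨t.2, t.2, hE _ _ _ hEp⟩, i, he⟩, ?_⟩
    rintro t' ⟨ht', i', he'⟩
    obtain ⟨-, ht', hE0⟩ := Finset.mem_filter.1 ht'
    -- A second chosen triple at `e` would also have its path's triangle number 0 selected; both
    -- contain `e`, so they coincide.
    obtain ⟨s', hs', hr'⟩ := (hE _ _ i' hE0 ⟨0, hpos _⟩).2 (by simp)
    have hmem : Point.elem e ∈ Set.range s' := by
      rw [hr', elem_mem_pathTrianglePoints]
      exact ⟨rfl, he'⟩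
    obtain rfl := huniq hs hs' hv hmem
    rw [ha, ← range_points_inl] at hr'
    have := G.range_points_injective hr'
    injection this with this
    have := congrArg (fun x => x.1.1.1) this
    exact this.symm
  · simp [points] at hv'

end TrianglePathGraph

theorem proposition1 {X Y Z : Type*} [Fintype X] [Fintype Y] [Fintype Z] (I : P3DM X Y Z)
    (G : TrianglePathGraph I) : G.HasAlternatingPattern ↔ I.IsYes :=
  ⟨G.isYes_of_hasAlternatingPattern, G.hasAlternatingPattern_of_isYes⟩
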